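/- Let $d\ge 6$. For every $m\ge 1$ let $W=W_m\in\mathbb R^{d\times m}$ be a random matrix with i.i.d. $N(0,1/m)$ entries (all defined on one probability space, with arbitrary dependence between different $m$), and let $W^{(i)}\in\mathbb R^d$ be its $i$-th column. For $x\in\mathbb R^d$ let $X=\sigma(x^\top W)\in\mathbb R^m$, where $\sigma(t)=\max(t,0)$ is applied componentwise, and for $1\le\alpha<\beta\le d$ let $v^{(\alpha,\beta)}\in\mathbb R^m$ have the components $$v^{(\alpha,\beta)}_i=\sqrt{d+2}\,\frac{W^{(i)}_\alpha W^{(i)}_\beta}{\|W^{(i)}\|},\qquad i=1,\dots,m.$$ Write $x_{\alpha\beta}=(x_\alpha,x_\beta)$, let $x_{-\alpha\beta}$ be $x$ with the components $\alpha,\beta$ removed, let $r_{\alpha\beta}=\|x_{\alpha\beta}\|^2/\|x\|^2$ for $x\ne0$, let $\|\cdot\|$ be the Euclidean norm and $B$ the beta function, and put $$F_{\alpha\beta}(x)=\frac{d\sqrt{d+2}}{2\pi(d+1)}\,B\!\left(\tfrac d2,\tfrac12\right)\frac{x_\alpha x_\beta}{\|x\|}.$$ There are an absolute constant $C$ and,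 for every $d\ge6$ and $1\le\alpha<\beta\le d$, a function $h_{\alpha\beta}:\mathbb R\times\mathbb R\to\mathbb R$ (depending on $d,\alpha,\beta$ only) with $$|h_{\alpha\beta}(p,r)|\le C\,|p|\,r^2\qquad\text{for all }p\in\mathbb R,\ 0<r<1,$$ such that for every $x\in\mathbb R^d$ with $x\neq0$, as $m\to\infty$: 1. if $x_\alpha=0$ or $x_\beta=0$, then $X^\top v^{(\alpha,\beta)}\to 0$ in probability; 2. if $x_{-\alpha\beta}=0$, then $X^\top v^{(\alpha,\beta)}\to F_{\alpha\beta}(x)$ in probability; 3. otherwise, $$X^\top v^{(\alpha,\beta)}\to F_{\alpha\beta}(x)+h_{\alpha\beta}\!\left(\frac{x_\alpha x_\beta}{\|x_{\alpha\beta}\|},\,r_{\alpha\beta}\right)\quad\text{in probability},$$ so that the remainder is $O\!\left(\frac{x_\alpha x_\beta}{\|x_{\alpha\beta}\|}\,r_{\alpha\beta}^2\right)$. -/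

import Mathlib

open MeasureTheory ProbabilityTheory Filter
open scoped Matrix NNReal

universe u

/-- The ReLU function. -/
noncomputable def relu (t : ℝ) : ℝ := max t 0

/-- The ReLU activated covariate `X = σ(xᵀ W) ∈ ℝᵐ`, with `σ` applied to each component. -/
noncomputable def reluFeature {d m : ℕ} (x : EuclideanSpace ℝ (Fin d))
    (W : Matrix (Fin d) (Fin m) ℝ) : Fin m → ℝ :=
  fun i => relu ((x.ofLp ᵥ* W) i)

/-- The `i`-th column `W⁽ⁱ⁾` of `W`, as a vector of Euclidean space. -/
noncomputable def weightColumn {d m : ℕ} (W : Matrix (Fin d) (Fin m) ℝ) (i : Fin m) :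
    EuclideanSpace ℝ (Fin d) :=
  WithLp.toLp 2 (fun l => W l i)

/-- The vector `v^(α,β) ∈ ℝᵐ`, with components `√(d+2) W_α⁽ⁱ⁾ W_β⁽ⁱ⁾ / ‖W⁽ⁱ⁾‖`. -/
noncomputable def approxEigenvector {d m : ℕ} (W : Matrix (Fin d) (Fin m) ℝ) (α β : Fin d) :
    Fin m → ℝ :=
  fun i => Real.sqrt ((d : ℝ) + 2) * (W α i * W β i / ‖weightColumn W i‖)

/-- The random `d × m` matrix `W` on `(Ω, μ)` has i.i.d. entries with law `N(0, 1/m)`. -/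
structure IsGaussianWeight {Ω : Type u} [MeasurableSpace Ω] (μ : Measure Ω) {d m : ℕ}
    (W : Ω → Matrix (Fin d) (Fin m) ℝ) : Prop where
  law : ∀ (l : Fin d) (i : Fin m),
    HasLaw (fun ω => W ω l i) (gaussianReal 0 (1 / (m : ℝ≥0))) μ
  indep : iIndepFun (fun (k : Fin d × Fin m) (ω : Ω) => W ω k.1 k.2) μ

/-- The vector `x_{αβ} = (x_α, x_β)`. -/
noncomputable def keepPair {d : ℕ} (x : EuclideanSpace ℝ (Fin d)) (α β : Fin d) :
    EuclideanSpace ℝ (Fin 2) :=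
  !₂[x α, x β]

/-- The vector `x_{-αβ}`: `x` with its components `α` and `β` removed. -/
noncomputable def removePair {d : ℕ} (x : EuclideanSpace ℝ (Fin d)) (α β : Fin d) :
    EuclideanSpace ℝ {i : Fin d // i ≠ α ∧ i ≠ β} :=
  WithLp.toLp 2 (fun i => x i.1)

/-- The ratio `r_{αβ} = ‖x_{αβ}‖² / ‖x‖²`. -/
noncomputable def pairRatio {d : ℕ} (x : EuclideanSpace ℝ (Fin d)) (α β : Fin d) : ℝ :=
  ‖keepPair x α β‖ ^ 2 / ‖x‖ ^ 2

/-- The function `F_{αβ}(x) = d √(d+2) / (2π(d+1)) · B(d/2, 1/2) · x_α x_β / ‖x‖`. -/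
noncomputable def limitF {d : ℕ} (x : EuclideanSpace ℝ (Fin d)) (α β : Fin d) : ℝ :=
  (d : ℝ) * Real.sqrt ((d : ℝ) + 2) / (2 * Real.pi * ((d : ℝ) + 1))
    * ProbabilityTheory.beta ((d : ℝ) / 2) (1 / 2) * (x α * x β / ‖x‖)

/-! By `reluFeature_dotProduct_approxEigenvector`, the inner product is a sum over the columns of
`W` of one function, homogeneous of degree two. Columns are independent copies of `g / √m` with `g`
standard Gaussian, so the terms of row `m` have mean `M / m` and variance `V / m²`. Chebyshev's
inequality, applied to each row separately, gives convergence to `M` in probability; the coupling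
between rows plays no role.

The mean `M` is explicit. Polar coordinates (`integral_div_norm_stdGaussian`) trade the factor `1 /
‖g‖` for a quotient of Gamma values, leaving the moment `E[σ⟨x,g⟩ ⟨a,g⟩⟨b,g⟩]` of
`integral_relu_inner_mul_stdGaussian`. For `a = e_α`, `b = e_β` its term in `⟨a,b⟩` vanishes, and
the rest is exactly `F_{αβ}(x)`. Hence `C = 0` and `h = 0` suffice. -/

/-! ### Gaussian density and polar coordinates -/

section StdGaussian

open Module Real
open scoped RealInnerProductSpace

variable {E : Type*} [NormedAddCommGroup E] [InnerProductSpace ℝ E] [FiniteDimensional ℝ E]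
  [MeasurableSpace E] [BorelSpace E]

/-- The standard Gaussian measure has density `(2π)^(-n/2) exp (-‖x‖² / 2)`. -/
theorem stdGaussian_eq_withDensity :
    stdGaussian E = (volume : Measure E).withDensity (fun x => ENNReal.ofReal
      ((2 * π) ^ (-(finrank ℝ E / 2 : ℝ)) * exp (-‖x‖ ^ 2 / 2))) := by
  have hint : Integrable (fun x : E => (2 * π) ^ (-(finrank ℝ E / 2 : ℝ)) *
      exp (-‖x‖ ^ 2 / 2)) := by
    refine Integrable.const_mul ?_ _
    have h := (GaussianFourier.integrable_cexp_neg_mul_sq_norm_add (V := E) (b := 1 / 2)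
      (by norm_num) 0 0).re
    refine h.congr (.of_forall fun x => ?_)
    have : (-(1 / 2 : ℂ) * ‖x‖ ^ 2 + 0 * ⟪(0 : E), x⟫) = ((-‖x‖ ^ 2 / 2 : ℝ) : ℂ) := by
      push_cast; ring
    simp only [this]
    exact Complex.exp_ofReal_re _
  have := isFiniteMeasure_withDensity_ofReal hint.2
  refine Measure.ext_of_charFun (funext fun t => ?_)
  rw [charFun_stdGaussian, charFun_apply, integral_withDensity_eq_integral_toReal_smul
    (by fun_prop) (by simp)]
  -- The Fourier integral contributes `(π / b) ^ (n / 2) = (2π) ^ (n / 2)`, which cancels the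
  -- normalisation.
  have h := GaussianFourier.integral_cexp_neg_mul_sq_norm_add (V := E) (b := 1 / 2)
    (by norm_num) Complex.I t
  have hc : ∀ x : E, (ENNReal.ofReal ((2 * π) ^ (-(finrank ℝ E / 2 : ℝ)) *
      exp (-‖x‖ ^ 2 / 2))).toReal • Complex.exp (⟪x, t⟫ * Complex.I) =
      ((2 * π) ^ (-(finrank ℝ E / 2 : ℝ)) : ℝ) *
        Complex.exp (-(1 / 2 : ℂ) * ‖x‖ ^ 2 + Complex.I * ⟪t, x⟫) := by
    intro x
    rw [ENNReal.toReal_ofReal (by positivity), Complex.real_smul, Complex.ofReal_mul, mul_assoc,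
      Complex.ofReal_exp, ← Complex.exp_add, real_inner_comm]
    congr 2
    push_cast; ring
  simp_rw [hc]
  rw [integral_const_mul, h, ← mul_assoc]
  have hπ : (π / (1 / 2) : ℂ) = ((2 * π : ℝ) : ℂ) := by push_cast; ring
  have he : (finrank ℝ E / 2 : ℂ) = ((finrank ℝ E / 2 : ℝ) : ℂ) := by push_cast; ring
  rw [hπ, he, ← Complex.ofReal_cpow (by positivity), ← Complex.ofReal_mul,
    ← rpow_add (by positivity), neg_add_cancel, rpow_zero, Complex.ofReal_one, one_mul,
    Complex.I_sq]
  congr 1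
  ring

theorem integral_stdGaussian (f : E → ℝ) :
    ∫ x, f x ∂stdGaussian E =
      (2 * π) ^ (-(finrank ℝ E / 2 : ℝ)) * ∫ x, f x * exp (-‖x‖ ^ 2 / 2) := by
  rw [stdGaussian_eq_withDensity, integral_withDensity_eq_integral_toReal_smul
    (by fun_prop) (by simp), ← integral_const_mul]
  refine integral_congr_ae (.of_forall fun x => ?_)
  simp only
  rw [ENNReal.toReal_ofReal (by positivity), smul_eq_mul]
  ring

/-- Integration in polar coordinates of the product of a function of the direction and a function
of the norm. -/
theorem integral_mul_fun_norm_addHaar [Nontrivial E] (μ : Measure E) [μ.IsAddHaarMeasure]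
    {H : E → ℝ} (hH : ∀ t : ℝ, 0 < t → ∀ x, H (t • x) = H x) (φ : ℝ → ℝ) :
    ∫ x, H x * φ ‖x‖ ∂μ =
      (∫ y, H y ∂μ.toSphere) * ∫ r in Set.Ioi (0 : ℝ), r ^ (finrank ℝ E - 1) * φ r :=
  calc
    ∫ x, H x * φ ‖x‖ ∂μ = ∫ x : ({(0)}ᶜ : Set E), H x.1 * φ ‖x.1‖ ∂(μ.comap (↑)) := by
      rw [integral_subtype_comap (measurableSet_singleton _).compl fun x ↦ H x * φ ‖x‖,
        restrict_compl_singleton]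
    _ = ∫ x : ({(0)}ᶜ : Set E), H (‖x.1‖⁻¹ • x.1) * φ ‖x.1‖ ∂(μ.comap (↑)) := by
      refine integral_congr_ae (.of_forall fun x => ?_)
      simp only
      rw [hH _ (inv_pos.2 (norm_pos_iff.2 x.2))]
    _ = ∫ p, H p.1 * φ p.2 ∂μ.toSphere.prod (.volumeIoiPow (finrank ℝ E - 1)) := by
      simpa using μ.measurePreserving_homeomorphUnitSphereProd.integral_comp
        (Homeomorph.measurableEmbedding _)
        (fun p : Metric.sphere (0 : E) 1 × Set.Ioi (0 : ℝ) => H p.1 * φ p.2)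
    _ = (∫ y, H y ∂μ.toSphere) *
        ∫ r : Set.Ioi (0 : ℝ), φ r ∂.volumeIoiPow (finrank ℝ E - 1) :=
      integral_prod_mul (fun y : Metric.sphere (0 : E) 1 => H y)
        (fun r : Set.Ioi (0 : ℝ) => φ r)
    _ = _ := by
      congr 1
      simp only [Measure.volumeIoiPow, ENNReal.ofReal]
      rw [integral_withDensity_eq_integral_smul,
        integral_subtype_comap measurableSet_Ioi
          fun a ↦ Real.toNNReal (a ^ (finrank ℝ E - 1)) • φ a,
        setIntegral_congr_fun measurableSet_Ioi fun x hx ↦ ?_]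
      · simp only [NNReal.smul_def, Real.coe_toNNReal _ (pow_nonneg (Set.mem_Ioi.1 hx).le _),
          smul_eq_mul]
      · exact (measurable_subtype_coe.pow_const _).real_toNNReal

/-- Writing `2 ^ ((n - 1) / 2)` as `√2 ^ n / √2` avoids truncated subtraction and makes consecutive
moments differ visibly by a factor `√2`. -/
theorem integral_pow_mul_exp_neg_sq_div_two (n : ℕ) :
    ∫ r in Set.Ioi (0 : ℝ), r ^ n * exp (-r ^ 2 / 2) =
      √2 ^ n / √2 * Gamma ((n + 1) / 2) := by
  have h := integral_rpow_mul_exp_neg_mul_rpow (p := 2) (q := n) (b := 1 / 2) (by norm_num)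
    (by linarith [(Nat.cast_nonneg n : (0 : ℝ) ≤ n)]) (by norm_num)
  have e : ∫ r in Set.Ioi (0 : ℝ), r ^ n * exp (-r ^ 2 / 2) =
      ∫ r in Set.Ioi (0 : ℝ), r ^ (n : ℝ) * exp (-(1 / 2) * r ^ (2 : ℝ)) := by
    refine integral_congr_ae (.of_forall fun r => ?_)
    simp only [rpow_natCast, rpow_two]
    congr 2
    ring
  rw [e, h]
  congr 1
  have h2 : √2 * √2 = 2 := mul_self_sqrt (by norm_num)
  have hp : (1 / 2 : ℝ) ^ (-((n : ℝ) + 1) / 2) = √2 ^ (n + 1) := by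
    rw [one_div, inv_rpow (by norm_num), ← rpow_neg (by norm_num), sqrt_eq_rpow,
      ← rpow_natCast, ← rpow_mul (by norm_num)]
    congr 1
    push_cast; ring
  rw [hp, pow_succ]
  field_simp
  rw [sq_sqrt (by norm_num)]

/-- Dividing a function that is positively homogeneous of degree `k + 1` by the norm multiplies
its Gaussian integral by a quotient of Gamma values. -/
theorem integral_div_norm_stdGaussian [Nontrivial E] {f : E → ℝ} {k : ℕ}
    (hf : ∀ t : ℝ, 0 < t → ∀ x, f (t • x) = t ^ (k + 1) * f x) :
    √2 * Gamma ((finrank ℝ E + k + 1) / 2) * ∫ x, f x / ‖x‖ ∂stdGaussian E =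
      Gamma ((finrank ℝ E + k) / 2) * ∫ x, f x ∂stdGaussian E := by
  -- Away from the origin, `f / ‖x‖` and `f` are this degree-zero function times `‖x‖ ^ k` and `‖x‖
  -- ^ (k + 1)`. The spherical integral is common to both, so only the radial integrals differ.
  set H : E → ℝ := fun x => f x / ‖x‖ ^ (k + 1) with hHdef
  have hH : ∀ t : ℝ, 0 < t → ∀ x, H (t • x) = H x := by
    intro t ht x
    simp only [hHdef, hf t ht, norm_smul, mul_pow, norm_of_nonneg ht.le]
    rw [mul_div_mul_left _ _ (by positivity)]
  have hae : ∀ᵐ x : E, x ≠ 0 := Measure.ae_ne volume 0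
  have h (n : ℕ) := integral_mul_fun_norm_addHaar (volume : Measure E) hH
    (fun r => r ^ n * exp (-r ^ 2 / 2))
  have e1 : ∫ x, f x / ‖x‖ * exp (-‖x‖ ^ 2 / 2) =
      ∫ x : E, H x * (‖x‖ ^ k * exp (-‖x‖ ^ 2 / 2)) := by
    refine integral_congr_ae (hae.mono fun x hx => ?_)
    have := norm_pos_iff.2 hx
    simp only [hHdef, pow_succ]
    field_simp
  have e2 : ∫ x, f x * exp (-‖x‖ ^ 2 / 2) =
      ∫ x : E, H x * (‖x‖ ^ (k + 1) * exp (-‖x‖ ^ 2 / 2)) := by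
    refine integral_congr_ae (hae.mono fun x hx => ?_)
    have := norm_pos_iff.2 hx
    simp only [hHdef]
    field_simp
  have hd : 1 ≤ finrank ℝ E := finrank_pos
  rw [integral_stdGaussian, integral_stdGaussian, e1, e2, h, h]
  simp_rw [← mul_assoc, ← pow_add, integral_pow_mul_exp_neg_sq_div_two]
  have c1 : ((finrank ℝ E - 1 + k : ℕ) : ℝ) + 1 = finrank ℝ E + k := by
    push_cast [Nat.cast_sub hd]; ring
  have c2 : ((finrank ℝ E - 1 + (k + 1) : ℕ) : ℝ) + 1 = finrank ℝ E + k + 1 := by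
    push_cast [Nat.cast_sub hd]; ring
  rw [c1, c2, ← add_assoc, pow_succ]
  ring

end StdGaussian

/-! ### Gaussian moments involving the ReLU -/

section ReluMoments

open Module Real
open scoped RealInnerProductSpace

theorem measurable_relu : Measurable relu := measurable_id.max measurable_const

theorem abs_relu_le (t : ℝ) : |relu t| ≤ |t| := by
  rw [relu, abs_of_nonneg (le_max_right _ _)]
  exact max_le (le_abs_self t) (abs_nonneg t)

theorem relu_mul {c : ℝ} (hc : 0 ≤ c) (t : ℝ) : relu (c * t) = c * relu t := by
  rw [relu, relu, mul_max_of_nonneg _ _ hc, mul_zero]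

theorem integral_relu_mul_pow_gaussianReal (n : ℕ) :
    ∫ z, relu z * z ^ n ∂gaussianReal 0 1 =
      (√(2 * π))⁻¹ * (√2 ^ (n + 1) / √2 * Gamma (((n + 1 : ℕ) + 1) / 2)) := by
  rw [integral_gaussianReal_eq_integral_smul one_ne_zero, ← integral_pow_mul_exp_neg_sq_div_two,
    ← integral_const_mul, ← integral_indicator measurableSet_Ioi]
  refine integral_congr_ae (.of_forall fun z => ?_)
  by_cases hz : 0 < z
  · simp only [Set.indicator_of_mem (Set.mem_Ioi.2 hz), relu, max_eq_left hz.le, gaussianPDFReal,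
      smul_eq_mul, NNReal.coe_one, mul_one, sub_zero]
    ring
  · simp [relu, max_eq_right (not_lt.1 hz), hz]

theorem integral_relu_gaussianReal :
    ∫ z, relu z ∂gaussianReal 0 1 = (√(2 * π))⁻¹ := by
  have h := integral_relu_mul_pow_gaussianReal 0
  norm_num at h
  simpa using h

theorem integral_relu_mul_sq_gaussianReal :
    ∫ z, relu z * z ^ 2 ∂gaussianReal 0 1 = 2 * (√(2 * π))⁻¹ := by
  have h := integral_relu_mul_pow_gaussianReal 2
  norm_num [Gamma_two] at h
  rw [h, show (3 : ℕ) = 2 + 1 from rfl, pow_succ, sq_sqrt (by norm_num),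
    sqrt_mul (by norm_num)]
  field_simp

variable {E : Type*} [NormedAddCommGroup E] [InnerProductSpace ℝ E] [FiniteDimensional ℝ E]
  [MeasurableSpace E] [BorelSpace E]

/-- Functions of polynomial growth are in every `Lᵖ` of the standard Gaussian measure. -/
theorem memLp_stdGaussian_of_norm_le_pow {f : E → ℝ} (hf : Measurable f) {C : ℝ} {n : ℕ}
    (hn : n ≠ 0) (h : ∀ x, ‖f x‖ ≤ C * ‖x‖ ^ n) (p : ℝ≥0) :
    MemLp f p (stdGaussian E) := by
  have h1 : MemLp (id : E → E) (n * p) (stdGaussian E) :=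
    IsGaussian.memLp_id _ _ (by finiteness)
  have h2 : MemLp (fun x : E => ‖x‖ ^ n) p (stdGaussian E) := by
    have := h1.norm_rpow_div n
    simp only [id, ENNReal.toReal_natCast, rpow_natCast] at this
    rwa [mul_comm, ENNReal.mul_div_cancel_right (by exact_mod_cast hn) (by simp)] at this
  refine (h2.const_mul C).of_le hf.aestronglyMeasurable (.of_forall fun x => ?_)
  exact (h x).trans (le_abs_self _)

theorem integrable_stdGaussian_of_norm_le_pow {f : E → ℝ} (hf : Measurable f) {C : ℝ} {n : ℕ}
    (hn : n ≠ 0) (h : ∀ x, ‖f x‖ ≤ C * ‖x‖ ^ n) : Integrable f (stdGaussian E) :=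
  memLp_one_iff_integrable.1 (by simpa using memLp_stdGaussian_of_norm_le_pow hf hn h 1)

theorem map_inner_stdGaussian (a : E) :
    (stdGaussian E).map (fun g => ⟪a, g⟫) = gaussianReal 0 (‖a‖₊ ^ 2) := by
  have h := IsGaussian.map_eq_gaussianReal (μ := stdGaussian E) (innerSL ℝ a)
  rw [variance_dual_stdGaussian, integral_strongDual_stdGaussian, innerSL_apply_norm] at h
  convert h using 2
  · ext
    simp
  · rw [toNNReal_pow (norm_nonneg a), norm_toNNReal]

theorem covariance_inner_stdGaussian (a b : E) :
    cov[fun g => ⟪a, g⟫, fun g => ⟪b, g⟫; stdGaussian E] = ⟪a, b⟫ := by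
  have h := covarianceBilin_apply_eq_cov (μ := stdGaussian E) (IsGaussian.memLp_two_id) a b
  rw [covarianceBilin_stdGaussian] at h
  simpa [innerSL_apply_apply ℝ] using h.symm

/-- Jointly Gaussian variables with zero covariance are independent. -/
theorem indepFun_inner_stdGaussian {a b : E} (h : ⟪a, b⟫ = 0) :
    IndepFun (fun g => ⟪a, g⟫) (fun g => ⟪b, g⟫) (stdGaussian E) := by
  refine HasGaussianLaw.indepFun_of_covariance_eq_zero ?_ ?_
  · exact (IsGaussian.hasGaussianLaw_id (μ := stdGaussian E)).map_fun
      ((innerSL ℝ a).prod (innerSL ℝ b))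
  · rw [covariance_inner_stdGaussian, h]

theorem integral_inner_sq_stdGaussian (a : E) :
    ∫ g, ⟪a, g⟫ ^ 2 ∂stdGaussian E = ‖a‖ ^ 2 := by
  have h := variance_dual_stdGaussian (innerSL ℝ a)
  rw [variance_of_integral_eq_zero (by fun_prop) (integral_strongDual_stdGaussian _)] at h
  simpa using h

theorem integral_comp_inner_stdGaussian {u : E} (hu : ‖u‖ = 1) {φ : ℝ → ℝ} (hφ : Measurable φ) :
    ∫ g, φ ⟪u, g⟫ ∂stdGaussian E = ∫ z, φ z ∂gaussianReal 0 1 := by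
  have h : (stdGaussian E).map (fun g => ⟪u, g⟫) = gaussianReal 0 1 := by
    rw [map_inner_stdGaussian]
    congr 1
    ext
    simp [hu]
  rw [← h, integral_map (by fun_prop) hφ.aestronglyMeasurable]

theorem norm_relu_inner_mul_le {F : Type*} [NormedAddCommGroup F] [InnerProductSpace ℝ F]
    (x a b g : F) :
    ‖relu ⟪x, g⟫ * (⟪a, g⟫ * ⟪b, g⟫)‖ ≤ (‖x‖ * (‖a‖ * ‖b‖)) * ‖g‖ ^ 3 := by
  have h (y : F) : |⟪y, g⟫| ≤ ‖y‖ * ‖g‖ := abs_real_inner_le_norm y g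
  calc ‖relu ⟪x, g⟫ * (⟪a, g⟫ * ⟪b, g⟫)‖ = |relu ⟪x, g⟫| * (|⟪a, g⟫| * |⟪b, g⟫|) := by
        rw [norm_eq_abs, abs_mul, abs_mul]
    _ ≤ (‖x‖ * ‖g‖) * ((‖a‖ * ‖g‖) * (‖b‖ * ‖g‖)) := by
        gcongr
        · exact (abs_relu_le _).trans (h x)
        · exact h a
        · exact h b
    _ = _ := by ring

theorem measurable_relu_inner_mul (x a b : E) :
    Measurable fun g : E => relu ⟪x, g⟫ * (⟪a, g⟫ * ⟪b, g⟫) :=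
  (measurable_relu.comp (by fun_prop)).mul (by fun_prop)

theorem integrable_relu_inner_mul (x a b : E) :
    Integrable (fun g : E => relu ⟪x, g⟫ * (⟪a, g⟫ * ⟪b, g⟫)) (stdGaussian E) :=
  integrable_stdGaussian_of_norm_le_pow (measurable_relu_inner_mul x a b) (by norm_num)
    (norm_relu_inner_mul_le x a b)

/-- Split `a = b + c u` with `b ⟂ u`. Independence of `⟨b,g⟩` and `⟨u,g⟩` reduces everything to
one-dimensional moments, and the cross term dies because `⟨b,g⟩` is centred. -/
theorem integral_relu_inner_mul_sq_stdGaussian {u : E} (hu : ‖u‖ = 1) (a : E) :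
    ∫ g, relu ⟪u, g⟫ * (⟪a, g⟫ * ⟪a, g⟫) ∂stdGaussian E =
      (√(2 * π))⁻¹ * (‖a‖ ^ 2 + ⟪a, u⟫ ^ 2) := by
  set c : ℝ := ⟪a, u⟫ with hc
  set b : E := a - c • u with hb
  have hub : ⟪u, b⟫ = 0 := by
    rw [hb, inner_sub_right, inner_smul_right, real_inner_self_eq_norm_sq, hu, hc,
      real_inner_comm]
    ring
  have hnb : ‖b‖ ^ 2 = ‖a‖ ^ 2 - c ^ 2 := by
    rw [hb, norm_sub_sq_real, inner_smul_right, norm_smul, hu, ← hc, mul_one, norm_eq_abs, sq_abs]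
    ring
  have hab (g : E) : ⟪a, g⟫ = ⟪b, g⟫ + c * ⟪u, g⟫ := by
    rw [hb, inner_sub_left, real_inner_smul_left]; ring
  have hind := indepFun_inner_stdGaussian hub
  have e (g : E) : relu ⟪u, g⟫ * (⟪a, g⟫ * ⟪a, g⟫) = relu ⟪u, g⟫ * (⟪b, g⟫ * ⟪b, g⟫) +
      (2 * c * (relu ⟪u, g⟫ * (⟪u, g⟫ * ⟪b, g⟫)) +
        c ^ 2 * (relu ⟪u, g⟫ * (⟪u, g⟫ * ⟪u, g⟫))) := by
    rw [hab]; ring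
  have i (y z : E) := integrable_relu_inner_mul u y z
  simp_rw [e]
  rw [integral_add (i b b) (g := fun g => 2 * c * (relu ⟪u, g⟫ * (⟪u, g⟫ * ⟪b, g⟫)) +
      c ^ 2 * (relu ⟪u, g⟫ * (⟪u, g⟫ * ⟪u, g⟫))) (((i _ _).const_mul _).add ((i _ _).const_mul _)),
    integral_add ((i _ _).const_mul _) ((i _ _).const_mul _), integral_const_mul,
    integral_const_mul]
  have h1 : ∫ g, relu ⟪u, g⟫ * (⟪b, g⟫ * ⟪b, g⟫) ∂stdGaussian E = (√(2 * π))⁻¹ * ‖b‖ ^ 2 := by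
    have := (hind.comp (φ := relu) (ψ := fun t => t * t) measurable_relu
      (by fun_prop)).integral_fun_mul_eq_mul_integral
      (measurable_relu.comp (by fun_prop)).aestronglyMeasurable (by fun_prop)
    simp only [Function.comp_apply] at this
    rw [this, integral_comp_inner_stdGaussian hu measurable_relu, integral_relu_gaussianReal]
    simp_rw [← sq]
    rw [integral_inner_sq_stdGaussian]
  have h2 : ∫ g, relu ⟪u, g⟫ * (⟪u, g⟫ * ⟪b, g⟫) ∂stdGaussian E = 0 := by
    have := (hind.comp (φ := fun t => relu t * t) (ψ := id) (measurable_relu.mul measurable_id)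
      measurable_id).integral_fun_mul_eq_mul_integral
      ((measurable_relu.mul measurable_id).comp (by fun_prop)).aestronglyMeasurable
      (by fun_prop)
    simp only [Function.comp_apply, id] at this
    simp_rw [← mul_assoc]
    rw [this]
    have h0 : ∫ g, ⟪b, g⟫ ∂stdGaussian E = 0 := integral_strongDual_stdGaussian (innerSL ℝ b)
    rw [h0, mul_zero]
  have h3 : ∫ g, relu ⟪u, g⟫ * (⟪u, g⟫ * ⟪u, g⟫) ∂stdGaussian E = 2 * (√(2 * π))⁻¹ := by
    rw [← integral_relu_mul_sq_gaussianReal, ← integral_comp_inner_stdGaussian hu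
      (φ := fun z => relu z * z ^ 2) (measurable_relu.mul (measurable_id.pow_const 2))]
    simp [sq]
  rw [h1, h2, h3, hnb]
  ring

theorem integral_relu_inner_mul_stdGaussian {x : E} (hx : x ≠ 0) (a b : E) :
    ∫ g, relu ⟪x, g⟫ * (⟪a, g⟫ * ⟪b, g⟫) ∂stdGaussian E =
      (√(2 * π))⁻¹ * (‖x‖ * ⟪a, b⟫ + ⟪a, x⟫ * ⟪b, x⟫ / ‖x‖) := by
  have hx' : ‖x‖ ≠ 0 := norm_ne_zero_iff.2 hx
  set u : E := ‖x‖⁻¹ • x with hu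
  have hun : ‖u‖ = 1 := by rw [hu, norm_smul, norm_inv, norm_norm, inv_mul_cancel₀ hx']
  -- Polarisation in `a`, `b` and homogeneity in `x` reduce to the square case with a unit vector.
  have e (g : E) : relu ⟪x, g⟫ * (⟪a, g⟫ * ⟪b, g⟫) =
      ‖x‖ / 4 * (relu ⟪u, g⟫ * (⟪a + b, g⟫ * ⟪a + b, g⟫) -
        relu ⟪u, g⟫ * (⟪a - b, g⟫ * ⟪a - b, g⟫)) := by
    have : x = ‖x‖ • u := by rw [hu, smul_inv_smul₀ hx']
    conv_lhs => rw [this]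
    rw [real_inner_smul_left, relu_mul (norm_nonneg x), inner_add_left, inner_sub_left]
    ring
  simp_rw [e]
  rw [integral_const_mul, integral_sub (integrable_relu_inner_mul _ _ _)
    (integrable_relu_inner_mul _ _ _), integral_relu_inner_mul_sq_stdGaussian hun,
    integral_relu_inner_mul_sq_stdGaussian hun, norm_add_sq_real, norm_sub_sq_real,
    inner_add_left, inner_sub_left, hu, inner_smul_right, inner_smul_right]
  field_simp
  ring

end ReluMoments

/-! ### Weak law for triangular arrays -/

section WeakLaw

open Real
open scoped Topology

/-- A weak law of large numbers for triangular arrays: row sums of `m` pairwise independent terms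
of mean `M / m` and variance `V / m²` converge to `M` in probability. -/
theorem tendstoInMeasure_sum_of_pairwise_indepFun {Ω : Type*} [MeasurableSpace Ω] {μ : Measure Ω}
    [IsProbabilityMeasure μ] {Y : (m : ℕ) → Fin m → Ω → ℝ} {M V : ℝ}
    (hL : ∀ m i, MemLp (Y m i) 2 μ) (hI : ∀ m, Pairwise fun i j => Y m i ⟂ᵢ[μ] Y m j)
    (hM : ∀ m i, ∫ ω, Y m i ω ∂μ = M / m) (hV : ∀ m i, Var[Y m i; μ] = V / m ^ 2) :
    TendstoInMeasure μ (fun m ω => ∑ i, Y m i ω) atTop (fun _ => M) := by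
  rw [tendstoInMeasure_iff_norm]
  intro ε hε
  have hlim : Tendsto (fun m : ℕ => ENNReal.ofReal (V / m / ε ^ 2)) atTop (𝓝 0) := by
    have := ENNReal.tendsto_ofReal ((tendsto_const_div_atTop_nhds_zero_nat V).div_const (ε ^ 2))
    simpa using this
  refine tendsto_of_tendsto_of_tendsto_of_le_of_le' tendsto_const_nhds hlim
    (.of_forall fun _ => zero_le) ?_
  -- The empty row `m = 0` has sum `0` rather than mean `M`, so it is discarded.
  filter_upwards [eventually_ne_atTop 0] with m hm
  have hm' : (m : ℝ) ≠ 0 := Nat.cast_ne_zero.2 hm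
  have hS : MemLp (∑ i, Y m i) 2 μ := memLp_finsetSum' _ fun i _ => hL m i
  have hmean : ∫ ω, (∑ i, Y m i) ω ∂μ = M := by
    simp_rw [Finset.sum_apply]
    rw [integral_finsetSum _ fun i _ => (hL m i).integrable one_le_two]
    simp_rw [hM]
    rw [Finset.sum_const, Finset.card_univ, Fintype.card_fin, nsmul_eq_mul]
    field_simp
  have hvar : Var[∑ i, Y m i; μ] = V / m := by
    rw [IndepFun.variance_sum (fun i _ => hL m i) fun i _ j _ hij => hI m hij]
    simp_rw [hV]
    rw [Finset.sum_const, Finset.card_univ, Fintype.card_fin, nsmul_eq_mul]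
    field_simp
  have h := meas_ge_le_variance_div_sq hS hε
  rw [hmean, hvar] at h
  simpa [Real.norm_eq_abs] using h

end WeakLaw

/-! ### Contribution of a single neuron and its mean -/

section Neuron

open Module Real
open scoped RealInnerProductSpace

variable {d : ℕ}

/-- The contribution to `Xᵀ v^(α,β)` of a neuron with weight vector `w`. -/
noncomputable def neuronTerm (x : EuclideanSpace ℝ (Fin d)) (α β : Fin d)
    (w : EuclideanSpace ℝ (Fin d)) : ℝ :=
  relu ⟪x, w⟫ * (√((d : ℝ) + 2) * (w α * w β / ‖w‖))

theorem reluFeature_dotProduct_approxEigenvector {m : ℕ} (x : EuclideanSpace ℝ (Fin d))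
    (W : Matrix (Fin d) (Fin m) ℝ) (α β : Fin d) :
    reluFeature x W ⬝ᵥ approxEigenvector W α β =
      ∑ i, neuronTerm x α β (weightColumn W i) := by
  refine Finset.sum_congr rfl fun i _ => ?_
  have : (x.ofLp ᵥ* W) i = ⟪x, weightColumn W i⟫ := by
    simp [Matrix.vecMul, dotProduct, PiLp.inner_apply, weightColumn, mul_comm]
  rw [reluFeature, this]
  rfl

theorem measurable_neuronTerm (x : EuclideanSpace ℝ (Fin d)) (α β : Fin d) :
    Measurable (neuronTerm x α β) :=
  (measurable_relu.comp (by fun_prop)).mul (by fun_prop)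

theorem neuronTerm_smul (x : EuclideanSpace ℝ (Fin d)) (α β : Fin d) {t : ℝ} (ht : 0 < t)
    (w : EuclideanSpace ℝ (Fin d)) :
    neuronTerm x α β (t • w) = t ^ 2 * neuronTerm x α β w := by
  simp only [neuronTerm, inner_smul_right, relu_mul ht.le, norm_smul, norm_of_nonneg ht.le,
    PiLp.smul_apply, smul_eq_mul]
  field_simp

theorem norm_neuronTerm_le (x : EuclideanSpace ℝ (Fin d)) (α β : Fin d)
    (w : EuclideanSpace ℝ (Fin d)) :
    ‖neuronTerm x α β w‖ ≤ (‖x‖ * √((d : ℝ) + 2)) * ‖w‖ ^ 2 := by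
  have h1 : |relu ⟪x, w⟫| ≤ ‖x‖ * ‖w‖ := (abs_relu_le _).trans (abs_real_inner_le_norm x w)
  have h2 : |w α * w β / ‖w‖| ≤ ‖w‖ := by
    rw [abs_div, abs_norm, abs_mul]
    refine div_le_of_le_mul₀ (norm_nonneg w) (norm_nonneg w) ?_
    exact mul_le_mul (PiLp.norm_apply_le w α) (PiLp.norm_apply_le w β) (abs_nonneg _)
      (norm_nonneg w)
  rw [neuronTerm, norm_eq_abs, abs_mul, abs_mul, abs_of_nonneg (sqrt_nonneg _)]
  calc _ ≤ ‖x‖ * ‖w‖ * (√((d : ℝ) + 2) * ‖w‖) := by gcongr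
    _ = _ := by ring

theorem memLp_two_neuronTerm (x : EuclideanSpace ℝ (Fin d)) (α β : Fin d) :
    MemLp (neuronTerm x α β) 2 (stdGaussian (EuclideanSpace ℝ (Fin d))) := by
  simpa using memLp_stdGaussian_of_norm_le_pow (measurable_neuronTerm x α β) two_ne_zero
    (norm_neuronTerm_le x α β) 2

/-- The Gaussian mean of a neuron's contribution is exactly `F_{αβ}(x)`. -/
theorem integral_neuronTerm {x : EuclideanSpace ℝ (Fin d)} (hx : x ≠ 0) {α β : Fin d}
    (hαβ : α ≠ β) :
    ∫ w, neuronTerm x α β w ∂stdGaussian (EuclideanSpace ℝ (Fin d)) = limitF x α β := by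
  have : Nontrivial (EuclideanSpace ℝ (Fin d)) := ⟨x, 0, hx⟩
  have hd : (0 : ℝ) < d := Nat.cast_pos.2 (Fin.pos α)
  set f : EuclideanSpace ℝ (Fin d) → ℝ := fun w =>
    relu ⟪x, w⟫ * (⟪EuclideanSpace.single α (1 : ℝ), w⟫ * ⟪EuclideanSpace.single β (1 : ℝ), w⟫)
    with hf
  have hhom : ∀ t : ℝ, 0 < t → ∀ w, f (t • w) = t ^ (2 + 1) * f w := by
    intro t ht w
    simp only [hf, inner_smul_right, relu_mul ht.le]
    ring
  have hratio := integral_div_norm_stdGaussian hhom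
  have hterm (w : EuclideanSpace ℝ (Fin d)) :
      neuronTerm x α β w = √((d : ℝ) + 2) * (f w / ‖w‖) := by
    simp only [neuronTerm, hf, EuclideanSpace.inner_single_left, map_one, one_mul]
    ring
  have hint : ∫ w, f w ∂stdGaussian (EuclideanSpace ℝ (Fin d)) =
      (√(2 * π))⁻¹ * (x α * x β / ‖x‖) := by
    rw [hf, integral_relu_inner_mul_stdGaussian hx]
    simp [EuclideanSpace.inner_single_left, hαβ]
  simp_rw [hterm]
  rw [integral_const_mul]
  rw [hint, finrank_euclideanSpace_fin] at hratio
  -- Here `k = 2`. One Gamma recurrence on each side yields the factor `d / (d + 1)` and leaves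
  -- `Γ(d/2) / Γ((d+1)/2)`, which is `B(d/2, 1/2) / √π`.
  have g1 : Gamma (((d : ℝ) + (2 : ℕ) + 1) / 2) = ((d + 1) / 2) * Gamma ((d + 1) / 2) := by
    rw [← Gamma_add_one (by positivity)]
    congr 1
    push_cast; ring
  have g2 : Gamma (((d : ℝ) + (2 : ℕ)) / 2) = (d / 2) * Gamma (d / 2) := by
    rw [← Gamma_add_one (by positivity)]
    congr 1
    push_cast; ring
  have g3 : (d : ℝ) / 2 + 1 / 2 = (d + 1) / 2 := by ring
  rw [g1, g2] at hratio
  have hG : 0 < Gamma (((d : ℝ) + 1) / 2) := Gamma_pos_of_pos (by positivity)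
  have hI : ∫ w, f w / ‖w‖ ∂stdGaussian (EuclideanSpace ℝ (Fin d)) =
      d / 2 * Gamma (d / 2) * ((√(2 * π))⁻¹ * (x α * x β / ‖x‖)) /
        (√2 * ((d + 1) / 2 * Gamma ((d + 1) / 2))) := by
    rw [eq_div_iff (by positivity), ← hratio]
    ring
  rw [hI, limitF, beta, g3, Gamma_one_half_eq, sqrt_mul (by norm_num)]
  have hx' : ‖x‖ ≠ 0 := norm_ne_zero_iff.2 hx
  field_simp
  rw [sq_sqrt (by norm_num), sq_sqrt pi_pos.le]
  ring

end Neuron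

/-! ### Law and independence of the columns; the limit -/

section GaussianWeight

open Real

variable {Ω : Type u} [MeasurableSpace Ω] {μ : Measure Ω} {d m : ℕ}
  {W : Ω → Matrix (Fin d) (Fin m) ℝ}

theorem IsGaussianWeight.aemeasurable_weightColumn (hW : IsGaussianWeight μ W) (i : Fin m) :
    AEMeasurable (fun ω => weightColumn (W ω) i) μ := by
  have h : AEMeasurable (fun ω l => W ω l i) μ :=
    aemeasurable_pi_lambda _ fun l => (hW.law l i).aemeasurable
  exact (MeasurableEquiv.toLp 2 (Fin d → ℝ)).measurable.comp_aemeasurable h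

/-- A column of `W` is a standard Gaussian vector scaled by `1 / √m`. -/
theorem IsGaussianWeight.map_weightColumn (hW : IsGaussianWeight μ W) (i : Fin m) :
    μ.map (fun ω => weightColumn (W ω) i) =
      (stdGaussian (EuclideanSpace ℝ (Fin d))).map ((√m)⁻¹ • ·) := by
  have hind : iIndepFun (fun l ω => W ω l i) μ :=
    hW.indep.precomp (g := fun l => (l, i)) fun l l' h => (Prod.ext_iff.1 h).1
  have hm : (gaussianReal 0 1).map ((√m)⁻¹ * ·) = gaussianReal 0 (1 / (m : ℝ≥0)) := by
    rw [gaussianReal_map_const_mul, mul_zero, mul_one]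
    congr 1
    ext
    simp
  have hpi : μ.map (fun ω l => W ω l i) =
      (Measure.pi fun _ : Fin d => gaussianReal 0 1).map fun w l => (√m)⁻¹ * w l := by
    have := hind.isProbabilityMeasure
    rw [hind.map_fun_eq_pi_map fun l => (hW.law l i).aemeasurable,
      Measure.pi_map_pi fun l => by fun_prop, hm]
    exact congrArg Measure.pi (funext fun l => (hW.law l i).map_eq)
  have hmeas : AEMeasurable (fun ω l => W ω l i) μ :=
    aemeasurable_pi_lambda _ fun l => (hW.law l i).aemeasurable
  have hL : Measurable (WithLp.toLp 2 : (Fin d → ℝ) → EuclideanSpace ℝ (Fin d)) :=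
    (MeasurableEquiv.toLp 2 (Fin d → ℝ)).measurable
  rw [← map_pi_eq_stdGaussian, Measure.map_map (by fun_prop) hL]
  calc μ.map (fun ω => weightColumn (W ω) i)
      = (μ.map (fun ω l => W ω l i)).map (WithLp.toLp 2) :=
        (AEMeasurable.map_map_of_aemeasurable hL.aemeasurable hmeas).symm
    _ = _ := by
      rw [hpi, Measure.map_map hL (by fun_prop)]
      rfl

/-- Distinct columns are functions of disjoint blocks of an independent family. -/
theorem IsGaussianWeight.indepFun_weightColumn (hW : IsGaussianWeight μ W) {i j : Fin m}
    (hij : i ≠ j) :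
    IndepFun (fun ω => weightColumn (W ω) i) (fun ω => weightColumn (W ω) j) μ := by
  have h := hW.indep.indepFun_finset₀ (Finset.univ ×ˢ {i}) (Finset.univ ×ˢ {j})
    (Finset.disjoint_left.2 fun k hi hj => hij
      ((Finset.mem_singleton.1 (Finset.mem_product.1 hi).2).symm.trans
        (Finset.mem_singleton.1 (Finset.mem_product.1 hj).2)))
    fun k => (hW.law k.1 k.2).aemeasurable
  have hmeas (n : Fin m) : Measurable
      fun (w : (Finset.univ ×ˢ {n} : Finset (Fin d × Fin m)) → ℝ) =>
        (WithLp.toLp 2 fun l => w ⟨(l, n), by simp⟩ : EuclideanSpace ℝ (Fin d)) :=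
    (MeasurableEquiv.toLp 2 (Fin d → ℝ)).measurable.comp (by fun_prop)
  exact h.comp (hmeas i) (hmeas j)

/-- In every case the limit in probability of `Xᵀ v^(α,β)` is `F_{αβ}(x)`. -/
theorem tendstoInMeasure_reluFeature_dotProduct [IsProbabilityMeasure μ]
    {W : (m : ℕ) → Ω → Matrix (Fin d) (Fin m) ℝ} (hW : ∀ m, IsGaussianWeight μ (W m))
    {α β : Fin d} (hαβ : α ≠ β) {x : EuclideanSpace ℝ (Fin d)} (hx : x ≠ 0) :
    TendstoInMeasure μ
      (fun (m : ℕ) ω => reluFeature x (W m ω) ⬝ᵥ approxEigenvector (W m ω) α β)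
      atTop (fun _ => limitF x α β) := by
  simp_rw [reluFeature_dotProduct_approxEigenvector]
  have hmeas := measurable_neuronTerm x α β
  -- Degree-two homogeneity turns the scale `1 / √m` into `1 / m`, the scaling the weak law needs.
  -- The index `i` serves only to ensure `m > 0`.
  have hsmul : ∀ (m : ℕ) (i : Fin m), (fun w => neuronTerm x α β ((√m)⁻¹ • w)) =
      fun w => (m : ℝ)⁻¹ * neuronTerm x α β w := by
    intro m i
    have hm : (0 : ℝ) < m := Nat.cast_pos.2 (Fin.pos i)
    funext w
    rw [neuronTerm_smul x α β (by positivity), inv_pow, sq_sqrt hm.le]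
  refine tendstoInMeasure_sum_of_pairwise_indepFun
    (Y := fun m i ω => neuronTerm x α β (weightColumn (W m ω) i))
    (V := Var[neuronTerm x α β; stdGaussian _]) (fun m i => ?_) (fun m i j hij => ?_)
    (fun m i => ?_) fun m i => ?_
  · refine MemLp.comp_of_map (g := neuronTerm x α β) ?_ ((hW m).aemeasurable_weightColumn i)
    rw [(hW m).map_weightColumn i, memLp_map_measure_iff hmeas.aestronglyMeasurable (by fun_prop)]
    change MemLp (fun w => neuronTerm x α β ((√m)⁻¹ • w)) 2 _
    rw [hsmul m i]
    exact (memLp_two_neuronTerm x α β).const_mul _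
  · exact ((hW m).indepFun_weightColumn hij).comp hmeas hmeas
  · rw [← integral_map (f := neuronTerm x α β) ((hW m).aemeasurable_weightColumn i)
      hmeas.aestronglyMeasurable, (hW m).map_weightColumn i,
      integral_map (by fun_prop) hmeas.aestronglyMeasurable]
    simp_rw [hsmul m i]
    rw [integral_const_mul, integral_neuronTerm hx hαβ, inv_mul_eq_div]
  · have h1 := variance_map (X := neuronTerm x α β) hmeas.aemeasurable
      ((hW m).aemeasurable_weightColumn i)
    have h2 := variance_map (μ := stdGaussian (EuclideanSpace ℝ (Fin d)))
      (X := neuronTerm x α β) (Y := ((√m)⁻¹ • ·)) hmeas.aemeasurable (by fun_prop)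
    rw [(hW m).map_weightColumn i, h2] at h1
    refine h1.symm.trans ?_
    change Var[fun w => neuronTerm x α β ((√m)⁻¹ • w); _] = _
    rw [hsmul m i, variance_const_mul, inv_pow, inv_mul_eq_div]

end GaussianWeight

/-- The remainder `h` vanishes identically: rotation invariance of the Gaussian makes the limit
equal to `F_{αβ}(x)` for every `x ≠ 0`, and uniqueness of limits in probability leaves no other
choice of `h` at the points that occur. -/
theorem mainTheorem4 :
    ∃ C : ℝ, ∀ d : ℕ, 6 ≤ d → ∀ α β : Fin d, α < β →
      ∃ h : ℝ → ℝ → ℝ,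
        (∀ p r : ℝ, 0 < r → r < 1 → |h p r| ≤ C * (|p| * r ^ 2)) ∧
        ∀ (Ω : Type u) [MeasurableSpace Ω] (μ : Measure Ω) [IsProbabilityMeasure μ]
          (W : (m : ℕ) → Ω → Matrix (Fin d) (Fin m) ℝ),
          (∀ m : ℕ, IsGaussianWeight μ (W m)) →
          ∀ x : EuclideanSpace ℝ (Fin d), x ≠ 0 →
            ((x α = 0 ∨ x β = 0) →
              TendstoInMeasure μ
                (fun (m : ℕ) ω => reluFeature x (W m ω) ⬝ᵥ approxEigenvector (W m ω) α β)
                atTop (fun _ => (0 : ℝ))) ∧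
            (removePair x α β = 0 →
              TendstoInMeasure μ
                (fun (m : ℕ) ω => reluFeature x (W m ω) ⬝ᵥ approxEigenvector (W m ω) α β)
                atTop (fun _ => limitF x α β)) ∧
            ((x α ≠ 0 ∧ x β ≠ 0 ∧ removePair x α β ≠ 0) →
              TendstoInMeasure μ
                (fun (m : ℕ) ω => reluFeature x (W m ω) ⬝ᵥ approxEigenvector (W m ω) α β)
                atTop (fun _ => limitF x α β
                  + h (x α * x β / ‖keepPair x α β‖) (pairRatio x α β))) := by
  refine ⟨0, fun d _ α β hαβ => ⟨fun _ _ => 0, fun p r _ _ => by simp, ?_⟩⟩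
  intro Ω _ μ _ W hW x hx
  have key := tendstoInMeasure_reluFeature_dotProduct hW hαβ.ne hx
  refine ⟨fun h0 => ?_, fun _ => key, fun _ => by simpa only [add_zero] using key⟩
  have hF : limitF x α β = 0 := by
    rcases h0 with h0 | h0 <;> simp [limitF, h0]
  rwa [hF] at key
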